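/- All Banach spaces are real, and $\dim Y$ denotes the least cardinality of a subset of $Y$ with dense linear span. Write $Y<_f X$ (finitely representable) if for every $\varepsilon>0$ every finite-dimensional subspace $A$ of $Y$ admits an isomorphic embedding $T:A\to X$ with $\|T\|\,\|T^{-1}\|\le 1+\varepsilon$, and $Y<_F X$ (crudely finitely representable) if there is a constant $C$ such that every finite-dimensional subspace $A$ of $Y$ admits an isomorphic embedding $T:A\to X$ with $\|T\|\,\|T^{-1}\|\le C$. Let $X^f$ (resp. $X^F$) be the class of all Banach spaces $Y$ with $Y<_fX$ and $X<_fY$ (resp. $Y<_FX$ and $X<_FY$). A Banach space $E$ is *$f$-saturated* if it is of almost universal disposition with respect to the class of all Banach spaces $B$ with $B<_fE$ and $\dim B<\dim E$; that is, for all $A\subseteq B$ in this class, every isomorphic embedding $i:A\to E$ and every $\varepsilon>0$ there is an isomorphic embedding $\hat\imath:B\to E$ with $\hat\imath|_A=i$ and $\|\hat\imath\|\,\|\hat\imath^{-1}\|\le(1+\varepsilon)\|i\|\,\|i^{-1}\|$ (where $\|i\|\,\|i^{-1}\|$ is read as $1$ if $A=0$). $\mathfrak P^{\sim}(X^F)$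 is the class of all infinite-dimensional Banach spaces $V<_FX$ such that whenever a Banach space $Z\in X^F$ contains a subspace $V'$ isometric to $V$, there is a bounded linear projection of $Z$ onto $V'$. $\mathfrak J^{\sim}(X^F)$ is the class of all infinite-dimensional Banach spaces $V<_FX$ such that for every Banach space $Y<_FX$ and every closed subspace $Y_0\subseteq Y$, every bounded operator $Y_0\to V$ extends to a bounded operator $Y\to V$. **Theorem.** Let $X$ be a Banach space, and let $E\in X^f$ be $f$-saturated and a dual space (i.e. $E=W^*$ isometrically for some Banach space $W$). Let $F$ be an infinite-dimensional complemented subspace of $E$. Then $F\in\mathfrak P^{\sim}(X^F)=\mathfrak J^{\sim}(X^F)$; that is, $F$ belongs to both classes, and the two classes coincide. -/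

import Mathlib

universe u v

/-- `‖T‖ ‖T⁻¹‖ ≤ C` for an isomorphic embedding `T : A → B` (with `T⁻¹` defined on the image):
the two-sided estimate `m ‖a‖ ≤ ‖T a‖ ≤ C m ‖a‖` holds for some scale `m > 0`. -/
def HasDistortionLE {A : Type u} {B : Type v}
    [NormedAddCommGroup A] [NormedSpace ℝ A] [NormedAddCommGroup B] [NormedSpace ℝ B]
    (C : ℝ) (T : A →L[ℝ] B) : Prop :=
  ∃ m : ℝ, 0 < m ∧ ∀ a : A, m * ‖a‖ ≤ ‖T a‖ ∧ ‖T a‖ ≤ C * m * ‖a‖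

section Representability

variable (X : Type u) (Y : Type v)
  [NormedAddCommGroup X] [NormedSpace ℝ X] [NormedAddCommGroup Y] [NormedSpace ℝ Y]

/-- `X <_f Y`: `X` is finitely representable in `Y`. -/
def FinitelyRepresentable : Prop :=
  ∀ ε : ℝ, 0 < ε → ∀ A : Submodule ℝ X, FiniteDimensional ℝ A →
    ∃ T : A →L[ℝ] Y, HasDistortionLE (1 + ε) T

/-- `X <_F Y`: `X` is crudely finitely representable in `Y`. -/
def CrudelyFinitelyRepresentable : Prop :=
  ∃ C : ℝ, ∀ A : Submodule ℝ X, FiniteDimensional ℝ A →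
    ∃ T : A →L[ℝ] Y, HasDistortionLE C T

/-- `X ∈ Y^f`. -/
def FinitelyEquivalent : Prop :=
  FinitelyRepresentable X Y ∧ FinitelyRepresentable Y X

/-- `X ∈ Y^F`. -/
def CrudelyFinitelyEquivalent : Prop :=
  CrudelyFinitelyRepresentable X Y ∧ CrudelyFinitelyRepresentable Y X

end Representability

/-- The dimension of a Banach space: the least cardinality of a subset whose linear span is dense.
It is the linear dimension in the finite-dimensional case and the density character otherwise. -/
noncomputable def banachDim (X : Type u) [NormedAddCommGroup X] [NormedSpace ℝ X] : Cardinal.{u} :=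
  sInf {κ : Cardinal.{u} | ∃ S : Set X, Cardinal.mk S = κ ∧ Dense (Submodule.span ℝ S : Set X)}

/-- `X` is a space of almost universal disposition with respect to the class `K` of Banach spaces:
whenever `A`, `B` are in `K` and `A` is a subspace of `B` (via the isometric embedding `j`), every
isomorphic embedding `i : A → X` extends to an isomorphic embedding `i'` of `B` into `X` with
`‖i'‖ ‖i'⁻¹‖ ≤ (1 + ε) ‖i‖ ‖i⁻¹‖`. The bound `1 ≤ C` matters only for `A = 0`. -/
def AlmostUniversalDisposition
    (K : ∀ (B : Type u) [NormedAddCommGroup B] [NormedSpace ℝ B], Prop)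
    (X : Type u) [NormedAddCommGroup X] [NormedSpace ℝ X] : Prop :=
  ∀ (A B : Type u) [NormedAddCommGroup A] [NormedSpace ℝ A] [CompleteSpace A]
    [NormedAddCommGroup B] [NormedSpace ℝ B] [CompleteSpace B],
    K A → K B → ∀ (j : A →ₗᵢ[ℝ] B) (i : A →L[ℝ] X) (C : ℝ), 1 ≤ C → HasDistortionLE C i →
      ∀ ε : ℝ, 0 < ε →
        ∃ i' : B →L[ℝ] X, (∀ a : A, i' (j a) = i a) ∧ HasDistortionLE ((1 + ε) * C) i'

/-- `X` is `f`-saturated: of almost universal disposition with respect to the class of all Banach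
spaces that are finitely representable in `X` and have dimension strictly less than `dim X`. -/
def FSaturated (X : Type u) [NormedAddCommGroup X] [NormedSpace ℝ X] : Prop :=
  AlmostUniversalDisposition
    (fun (B : Type u) [NormedAddCommGroup B] [NormedSpace ℝ B] =>
      FinitelyRepresentable B X ∧ banachDim B < banachDim X) X

/-- `E = W*` for some Banach space `W`. -/
def IsDualBanachSpace (E : Type u) [NormedAddCommGroup E] [NormedSpace ℝ E] : Prop :=
  ∃ (W : Type u) (_ : NormedAddCommGroup W) (_ : NormedSpace ℝ W),
    CompleteSpace W ∧ Nonempty (E ≃ₗᵢ[ℝ] StrongDual ℝ W)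

section Classes

variable (X : Type u) [NormedAddCommGroup X] [NormedSpace ℝ X]
  (V : Type u) [NormedAddCommGroup V] [NormedSpace ℝ V]

/-- `V` is boundedly universally complemented in `X^F`: in every Banach space `Z ∈ X^F`, every
isometric copy of `V` is the range of a bounded linear projection. -/
def BoundedlyUniversallyComplemented : Prop :=
  ∀ (Z : Type u) [NormedAddCommGroup Z] [NormedSpace ℝ Z] [CompleteSpace Z],
    CrudelyFinitelyEquivalent Z X → ∀ j : V →ₗᵢ[ℝ] Z,
      ∃ P : Z →L[ℝ] Z, (∀ z : Z, P (P z) = P z) ∧ Set.range P = Set.range j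

/-- `V ∈ 𝔓~(X^F)`: `V` is infinite-dimensional, crudely finitely representable in `X` and boundedly
universally complemented in `X^F`. -/
def MemPTilde : Prop :=
  ¬ FiniteDimensional ℝ V ∧ CrudelyFinitelyRepresentable V X ∧
    BoundedlyUniversallyComplemented X V

/-- `V ∈ 𝔍~(X^F)`: `V` is crudely finitely representable in `X`, and for every Banach space
`Y <_F X` every bounded operator from a closed subspace of `Y` to `V` extends to a bounded operator
from `Y` to `V`. -/
def MemJTilde : Prop :=
  CrudelyFinitelyRepresentable V X ∧
    ∀ (Y : Type u) [NormedAddCommGroup Y] [NormedSpace ℝ Y] [CompleteSpace Y],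
      CrudelyFinitelyRepresentable Y X →
        ∀ Y₀ : Submodule ℝ Y, IsClosed (Y₀ : Set Y) → ∀ w : Y₀ →L[ℝ] V,
          ∃ w' : Y →L[ℝ] V, ∀ y : Y₀, w' (y : Y) = w y

end Classes

open Filter Topology

/-! ### Crude finite representability as a preorder -/

section Distortion

variable {A B D : Type*} [NormedAddCommGroup A] [NormedSpace ℝ A]
  [NormedAddCommGroup B] [NormedSpace ℝ B] [NormedAddCommGroup D] [NormedSpace ℝ D]

/-! Saturation makes `E` behave like an injective space locally, and an ultraproduct makes this
global. Locally: for finite-dimensional `A ⊆ B ⊆ E` and an operator `w : A → E`, the inclusion plus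
a small multiple of `w` is an embedding. Saturation extends it to `B`; subtracting the inclusion and
rescaling gives an extension of `w` with norm bounded by a universal multiple of that of `w`
(`FSaturated.exists_extension`). Globally: let `Y` and `V` be crudely finitely representable in `E`
and `w : Y₀ → V` with `Y₀ ⊆ Y`. Gluing the local extensions along an ultrafilter yields an embedding
`J` of `V` into an ultrapower of `E` and an extension of `J ∘ w` to `Y`
(`FSaturated.exists_ultrapower_extension`). It remains to retract the ultrapower onto `V`. If `V =
E` is a dual space, `J` is diagonal and weak-star limits retract, so `E` lies in 𝔍~, which passes to
complemented subspaces. If `V` lies in 𝔓~, the ultrapower, renormed to make `J` isometric, lies in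
`X^F`, and the projection given by 𝔓~ retracts. Conversely, extending the identity of a copy of `V`
gives a projection, so 𝔍~ is contained in 𝔓~. -/

theorem CrudelyFinitelyRepresentable.exists_normalized (h : CrudelyFinitelyRepresentable A B) :
    ∃ C : ℝ, 0 ≤ C ∧ ∀ S : Submodule ℝ A, FiniteDimensional ℝ S →
      ∃ T : S →L[ℝ] B, ∀ a : S, ‖a‖ ≤ ‖T a‖ ∧ ‖T a‖ ≤ C * ‖a‖ := by
  obtain ⟨C, hC⟩ := h
  -- `C` can be negative only when the source space is trivial.
  refine ⟨max C 0, le_max_right _ _, fun S hS => ?_⟩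
  obtain ⟨T, m, hm, hT⟩ := hC S hS
  refine ⟨m⁻¹ • T, fun a => ?_⟩
  have hn : ‖(m⁻¹ • T) a‖ = m⁻¹ * ‖T a‖ := by
    rw [smul_apply, norm_smul, Real.norm_of_nonneg (by positivity)]
  rw [hn]
  obtain ⟨h1, h2⟩ := hT a
  constructor
  · rw [inv_mul_eq_div, le_div_iff₀ hm]; linarith
  · rw [inv_mul_eq_div, div_le_iff₀ hm]
    have : C * (m * ‖a‖) ≤ max C 0 * (m * ‖a‖) :=
      mul_le_mul_of_nonneg_right (le_max_left _ _) (by positivity)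
    linarith

theorem CrudelyFinitelyRepresentable.of_normalized (C : ℝ)
    (h : ∀ S : Submodule ℝ A, FiniteDimensional ℝ S →
      ∃ T : S →L[ℝ] B, ∀ a : S, ‖a‖ ≤ ‖T a‖ ∧ ‖T a‖ ≤ C * ‖a‖) :
    CrudelyFinitelyRepresentable A B := by
  refine ⟨C, fun S hS => ?_⟩
  obtain ⟨T, hT⟩ := h S hS
  exact ⟨T, 1, one_pos, fun a => by simpa using hT a⟩

theorem CrudelyFinitelyRepresentable.trans (h₁ : CrudelyFinitelyRepresentable A B)
    (h₂ : CrudelyFinitelyRepresentable B D) : CrudelyFinitelyRepresentable A D := by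
  obtain ⟨C₁, hC₁, h₁⟩ := h₁.exists_normalized
  obtain ⟨C₂, hC₂, h₂⟩ := h₂.exists_normalized
  refine .of_normalized (C₂ * C₁) fun S hS => ?_
  obtain ⟨T, hT⟩ := h₁ S hS
  obtain ⟨R, hR⟩ := h₂ (LinearMap.range T.toLinearMap) inferInstance
  refine ⟨R.comp (T.codRestrict _ fun a => LinearMap.mem_range_self T.toLinearMap a),
    fun a => ?_⟩
  obtain ⟨h3, h4⟩ := hR (T.codRestrict _ (fun a => LinearMap.mem_range_self T.toLinearMap a) a)
  obtain ⟨h5, h6⟩ := hT a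
  have hn : ‖T.codRestrict _ (fun a => LinearMap.mem_range_self T.toLinearMap a) a‖ = ‖T a‖ := rfl
  rw [hn] at h3 h4
  rw [ContinuousLinearMap.comp_apply]
  refine ⟨h5.trans h3, h4.trans ?_⟩
  rw [mul_assoc]
  exact mul_le_mul_of_nonneg_left h6 hC₂

/-- A bounded operator that is bounded below makes its domain crudely finitely representable in
its codomain. -/
theorem CrudelyFinitelyRepresentable.of_boundedBelow (T : A →L[ℝ] B) (m : ℝ) (hm : 0 < m)
    (hT : ∀ a, m * ‖a‖ ≤ ‖T a‖) : CrudelyFinitelyRepresentable A B := by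
  refine ⟨‖T‖ / m, fun S _ => ⟨T.comp S.subtypeL, m, hm, fun a => ⟨hT a, ?_⟩⟩⟩
  rw [div_mul_cancel₀ _ hm.ne']
  exact T.le_opNorm a

theorem FinitelyRepresentable.crudely (h : FinitelyRepresentable A B) :
    CrudelyFinitelyRepresentable A B :=
  ⟨1 + 1, h 1 one_pos⟩

theorem Submodule.finitelyRepresentable (S : Submodule ℝ A) : FinitelyRepresentable S A := by
  intro ε hε R _
  refine ⟨S.subtypeL.comp R.subtypeL, 1, one_pos, fun a => ⟨?_, ?_⟩⟩
  · rw [one_mul]; exact le_rfl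
  · have h0 : ‖(S.subtypeL.comp R.subtypeL) a‖ = ‖a‖ := rfl
    rw [h0]
    nlinarith [norm_nonneg a]

end Distortion

/-! ### Finite-dimensional spaces fall below the dimension of an infinite-dimensional space -/

section Dimension

theorem banachDim_lt_aleph0 (B : Type u) [NormedAddCommGroup B] [NormedSpace ℝ B]
    [FiniteDimensional ℝ B] : banachDim B < Cardinal.aleph0 := by
  let b := Module.finBasis ℝ B
  refine lt_of_le_of_lt (csInf_le' ⟨Set.range b, rfl, ?_⟩)
    (Cardinal.mk_lt_aleph0_iff.2 (Set.finite_range b).to_subtype)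
  rw [b.span_eq]
  exact dense_univ

theorem aleph0_le_banachDim (E : Type u) [NormedAddCommGroup E] [NormedSpace ℝ E]
    (h : ¬ FiniteDimensional ℝ E) : Cardinal.aleph0 ≤ banachDim E := by
  refine le_csInf ⟨_, Set.univ, rfl, ?_⟩ ?_
  · rw [Submodule.span_univ]
    exact dense_univ
  · rintro _ ⟨S, rfl, hS⟩
    by_contra! hlt
    have hfin : S.Finite := Cardinal.lt_aleph0_iff_set_finite.1 hlt
    have : FiniteDimensional ℝ (Submodule.span ℝ S) := FiniteDimensional.span_of_finite ℝ hfin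
    have hcl : IsClosed (Submodule.span ℝ S : Set E) := Submodule.closed_of_finiteDimensional _
    have htop : Submodule.span ℝ S = ⊤ := by
      rw [← SetLike.coe_set_eq, ← hcl.closure_eq, hS.closure_eq]
      rfl
    rw [htop] at this
    exact h (Module.Finite.equiv (Submodule.topEquiv (R := ℝ) (M := E)))

end Dimension

/-! ### Uniform extension of operators between finite-dimensional spaces -/

section LocalExtension

variable {E : Type u} [NormedAddCommGroup E] [NormedSpace ℝ E]

/-- In an infinite-dimensional `f`-saturated space, operators into the space extend between
finite-dimensional subspaces with a uniform bound: perturb the inclusion by the operator, extend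
the resulting embedding, and subtract the inclusion again. -/
theorem FSaturated.exists_extension_subspace (hsat : FSaturated E)
    (hinf : ¬ FiniteDimensional ℝ E) (B : Submodule ℝ E) [FiniteDimensional ℝ B]
    (A : Submodule ℝ B) (w : A →ₗ[ℝ] E) (D : ℝ) (hD : 0 < D) (hw : ∀ a, ‖w a‖ ≤ D * ‖a‖) :
    ∃ w' : B →ₗ[ℝ] E, (∀ a : A, w' a = w a) ∧ ∀ b, ‖w' b‖ ≤ 20 * D * ‖b‖ := by
  -- A nonzero vector of `A` is needed below to bound the scale `m` of the extended embedding.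
  by_cases htriv : ∀ a : A, a = 0
  · refine ⟨0, fun a => by rw [htriv a]; simp, fun b => ?_⟩
    rw [LinearMap.zero_apply, norm_zero]
    positivity
  push Not at htriv
  obtain ⟨a₀, ha₀⟩ := htriv
  have hdim : ∀ (S : Type u) [NormedAddCommGroup S] [NormedSpace ℝ S] [FiniteDimensional ℝ S],
      banachDim S < banachDim E := fun S _ _ _ =>
    (banachDim_lt_aleph0 S).trans_le (aleph0_le_banachDim E hinf)
  have hAE : FinitelyRepresentable A E := by
    intro ε hε R _
    refine ⟨B.subtypeL.comp (A.subtypeL.comp R.subtypeL), 1, one_pos, fun a => ?_⟩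
    have h0 : ‖(B.subtypeL.comp (A.subtypeL.comp R.subtypeL)) a‖ = ‖a‖ := rfl
    rw [h0]
    constructor <;> nlinarith [norm_nonneg a]
  have : CompleteSpace A := FiniteDimensional.complete ℝ A
  have : CompleteSpace B := FiniteDimensional.complete ℝ B
  let wc : A →L[ℝ] E := LinearMap.toContinuousLinearMap w
  -- The factor `(2 * D)⁻¹` gives the perturbation norm at most 1/2, so `i` lies between 1/2 and 3/2
  -- and has distortion at most 3.
  let i : A →L[ℝ] E := B.subtypeL.comp A.subtypeL + (2 * D)⁻¹ • wc
  have hi : ∀ a : A, i a = (a : E) + (2 * D)⁻¹ • w a := fun a => rfl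
  have hsmall : ∀ a : A, ‖(2 * D)⁻¹ • w a‖ ≤ 2⁻¹ * ‖a‖ := fun a => by
    rw [norm_smul, Real.norm_of_nonneg (by positivity), inv_mul_le_iff₀ (by positivity)]
    calc ‖w a‖ ≤ D * ‖a‖ := hw a
      _ = 2 * D * (2⁻¹ * ‖a‖) := by ring
  have hnorm : ∀ a : A, ‖(a : E)‖ = ‖a‖ := fun a => rfl
  have hup : ∀ a, ‖i a‖ ≤ 3 / 2 * ‖a‖ := fun a => by
    rw [hi]
    linarith [norm_add_le (a : E) ((2 * D)⁻¹ • w a), hsmall a, hnorm a]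
  have hlow : ∀ a, 1 / 2 * ‖a‖ ≤ ‖i a‖ := fun a => by
    rw [hi]
    have := norm_sub_norm_le (a : E) (-((2 * D)⁻¹ • w a))
    rw [norm_neg, sub_neg_eq_add] at this
    linarith [hsmall a, hnorm a]
  obtain ⟨i', hi', m, hm, hdist⟩ := hsat A B ⟨hAE, hdim A⟩ ⟨B.finitelyRepresentable, hdim B⟩
    A.subtypeₗᵢ i 3 (by norm_num)
    ⟨1 / 2, by norm_num, fun a => ⟨hlow a, by linarith [hup a]⟩⟩ 1 one_pos
  have hm' : m ≤ 3 / 2 := by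
    have h1 := (hdist (a₀ : B)).1
    have h2 : i' (a₀ : B) = i a₀ := hi' a₀
    rw [h2] at h1
    have h3 : 0 < ‖a₀‖ := norm_pos_iff.2 ha₀
    exact le_of_mul_le_mul_right (h1.trans (hup a₀)) h3
  -- With `ε = 1` the distortion of `i'` is at most 6 at scale `m ≤ 3/2`, so its norm is at most 9.
  -- Subtracting the inclusion gives 10, and undoing the scaling gives `20 * D`.
  refine ⟨(2 * D) • (i'.toLinearMap - B.subtype), fun a => ?_, fun b => ?_⟩
  · have h2 : i' (a : B) = i a := hi' a
    change (2 * D) • (i' (a : B) - (a : E)) = w a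
    rw [h2, hi, add_sub_cancel_left, smul_inv_smul₀ (by positivity)]
  · change ‖(2 * D) • (i' b - (b : E))‖ ≤ _
    rw [norm_smul, Real.norm_of_nonneg (by positivity)]
    have h1 : ‖i' b‖ ≤ 9 * ‖b‖ := by
      refine (hdist b).2.trans (mul_le_mul_of_nonneg_right ?_ (norm_nonneg b))
      linarith
    have h2 : ‖i' b - (b : E)‖ ≤ 10 * ‖b‖ := by
      have h3 : ‖(b : E)‖ = ‖b‖ := rfl
      linarith [norm_sub_le (i' b) (b : E)]
    calc 2 * D * ‖i' b - (b : E)‖ ≤ 2 * D * (10 * ‖b‖) :=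
          mul_le_mul_of_nonneg_left h2 (by positivity)
      _ = 20 * D * ‖b‖ := by ring

/-- Transport along `T` to its range, a genuine subspace of `E`: the lower bound on `T` preserves
the bound `D`, and the upper bound costs the factor `C`. -/
theorem FSaturated.exists_extension (hsat : FSaturated E) (hinf : ¬ FiniteDimensional ℝ E)
    {B : Type*} [NormedAddCommGroup B] [NormedSpace ℝ B] [FiniteDimensional ℝ B]
    (T : B →L[ℝ] E) (C : ℝ) (hT : ∀ b, ‖b‖ ≤ ‖T b‖ ∧ ‖T b‖ ≤ C * ‖b‖)
    (A : Submodule ℝ B) (w : A →ₗ[ℝ] E) (D : ℝ) (hD : 0 < D) (hw : ∀ a, ‖w a‖ ≤ D * ‖a‖) :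
    ∃ w' : B →ₗ[ℝ] E, (∀ a : A, w' a = w a) ∧ ∀ b, ‖w' b‖ ≤ 20 * D * C * ‖b‖ := by
  have hinj : Function.Injective T.toLinearMap := by
    rw [← LinearMap.ker_eq_bot, LinearMap.ker_eq_bot']
    intro b hb
    have h1 := (hT b).1
    have h2 : T b = 0 := hb
    rw [h2, norm_zero] at h1
    exact norm_le_zero_iff.1 h1
  let e := LinearEquiv.ofInjective T.toLinearMap hinj
  let eA := e.submoduleMap A
  have heA : ∀ a : A, ((eA a : _) : LinearMap.range T.toLinearMap) = e a := fun a => rfl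
  have hnorm : ∀ b, ‖e b‖ = ‖T b‖ := fun b => rfl
  obtain ⟨w', hw', hb⟩ := hsat.exists_extension_subspace hinf (LinearMap.range T.toLinearMap)
    (A.map e.toLinearMap) (w ∘ₗ eA.symm.toLinearMap) D hD (fun a => by
      obtain ⟨a, rfl⟩ := eA.surjective a
      have h1 : (w ∘ₗ eA.symm.toLinearMap) (eA a) = w a := by simp
      rw [h1]
      refine (hw a).trans (mul_le_mul_of_nonneg_left ?_ hD.le)
      exact (hT a).1)
  refine ⟨w' ∘ₗ e.toLinearMap, fun a => ?_, fun b => ?_⟩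
  · have := hw' (eA a)
    rw [heA] at this
    simpa using this
  · refine (hb (e b)).trans ?_
    rw [hnorm, mul_assoc (20 * D)]
    exact mul_le_mul_of_nonneg_left (hT b).2 (by positivity)

end LocalExtension

/-! ### Ultrapowers: norm estimates, limits of local maps, weak-star retraction, global extension -/

section Ultrapower

variable {I : Type u} {E : Type u} [NormedAddCommGroup E] [NormedSpace ℝ E]

variable (E) in
/-- The bounded families in `E` that tend to `0` along the ultrafilter `U`. -/
def nullFamilies (U : Ultrafilter I) : Submodule ℝ (lp (fun _ : I => E) ⊤) where
  carrier := {f | Tendsto (fun i => f i) U (𝓝 0)}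
  zero_mem' := by
    change Tendsto (fun _ : I => (0 : E)) U (𝓝 0)
    exact tendsto_const_nhds
  add_mem' := fun {f g} hf hg => by
    change Tendsto (fun i => f i + g i) U (𝓝 0)
    simpa using Tendsto.add hf hg
  smul_mem' := fun c f hf => by
    change Tendsto (fun i => c • f i) U (𝓝 0)
    simpa using Tendsto.const_smul hf c

theorem mem_nullFamilies {U : Ultrafilter I} {f : lp (fun _ : I => E) ⊤} :
    f ∈ nullFamilies E U ↔ Tendsto (fun i => f i) U (𝓝 0) := Iff.rfl

instance nullFamilies.isClosed (U : Ultrafilter I) :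
    IsClosed (nullFamilies E U : Set (lp (fun _ : I => E) ⊤)) := by
  refine isClosed_of_closure_subset fun f hf => ?_
  rw [SetLike.mem_coe, mem_nullFamilies, Metric.tendsto_nhds]
  intro ε hε
  obtain ⟨g, hg, hfg⟩ := Metric.mem_closure_iff.1 hf (ε / 2) (half_pos hε)
  filter_upwards [Metric.tendsto_nhds.1 (mem_nullFamilies.1 hg) (ε / 2) (half_pos hε)] with i hi
  rw [dist_zero_right] at hi ⊢
  rw [dist_eq_norm] at hfg
  have h1 : ‖f i - g i‖ ≤ ‖f - g‖ := lp.norm_apply_le_norm (by simp) (f - g) i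
  have h2 : ‖f i‖ ≤ ‖f i - g i‖ + ‖g i‖ := by simpa using norm_add_le (f i - g i) (g i)
  linarith

variable (E) in
/-- The ultrapower of the normed space `E` along `U`. -/
abbrev Ultrapower (U : Ultrafilter I) : Type u :=
  lp (fun _ : I => E) ⊤ ⧸ nullFamilies E U

namespace Ultrapower

variable {U : Ultrafilter I}

variable (U) in
/-- The class of a bounded family in the ultrapower. -/
noncomputable def mk : lp (fun _ : I => E) ⊤ →ₗ[ℝ] Ultrapower E U := (nullFamilies E U).mkQ

theorem mk_surjective : Function.Surjective (mk U : lp (fun _ : I => E) ⊤ →ₗ[ℝ] _) :=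
  Submodule.mkQ_surjective _

theorem norm_mk_le (f : lp (fun _ : I => E) ⊤) : ‖mk U f‖ ≤ ‖f‖ :=
  Submodule.Quotient.norm_mk_le _ _

theorem mk_eq_mk {f g : lp (fun _ : I => E) ⊤} (h : ∀ᶠ i in U, f i = g i) :
    mk U f = mk U g := by
  refine (Submodule.Quotient.eq _).2 (mem_nullFamilies.2 ?_)
  refine tendsto_const_nhds.congr' ?_
  filter_upwards [h] with i hi
  change 0 = f i - g i
  rw [hi, sub_self]

/-- Truncating the family to `0` off a `U`-large set does not change its class. -/
theorem norm_mk_le_of_eventually {f : lp (fun _ : I => E) ⊤} {c : ℝ}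
    (h : ∀ᶠ i in U, ‖f i‖ ≤ c) : ‖mk U f‖ ≤ c := by
  classical
  have hc : 0 ≤ c := by
    obtain ⟨i, hi⟩ := h.exists
    exact (norm_nonneg _).trans hi
  have hle : ∀ i, ‖(if ‖f i‖ ≤ c then f i else 0 : E)‖ ≤ c := fun i => by
    split_ifs with hi
    · exact hi
    · simpa using hc
  let g : lp (fun _ : I => E) ⊤ := ⟨fun i => if ‖f i‖ ≤ c then f i else 0,
    memℓp_infty ⟨c, by rintro _ ⟨i, rfl⟩; exact hle i⟩⟩
  have hfg : mk U f = mk U g := mk_eq_mk (by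
    filter_upwards [h] with i hi
    exact (if_pos hi).symm)
  rw [hfg]
  exact (norm_mk_le g).trans (lp.norm_le_of_forall_le hc hle)

theorem le_norm_mk_of_eventually {f : lp (fun _ : I => E) ⊤} {c : ℝ}
    (h : ∀ᶠ i in U, c ≤ ‖f i‖) : c ≤ ‖mk U f‖ := by
  refine le_of_forall_pos_le_add fun ε hε => ?_
  obtain ⟨g, hg, hlt⟩ := Submodule.Quotient.norm_mk_lt (S := nullFamilies E U) (mk U f) hε
  have hnull : f - g ∈ nullFamilies E U := (Submodule.Quotient.eq _).1 hg.symm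
  have ht : Tendsto (fun i => f i - g i) U (𝓝 0) := hnull
  have ht' : Tendsto (fun i => ‖f i - g i‖) U (𝓝 0) := by simpa using ht.norm
  refine le_trans ?_ hlt.le
  have hlim : Tendsto (fun i => c - ‖f i - g i‖) U (𝓝 c) := by simpa using ht'.const_sub c
  refine le_of_tendsto hlim ?_
  filter_upwards [h] with i hi
  have h1 : ‖g i‖ ≤ ‖g‖ := lp.norm_apply_le_norm (by simp) g i
  have h2 : ‖f i‖ ≤ ‖f i - g i‖ + ‖g i‖ := by simpa using norm_add_le (f i - g i) (g i)
  linarith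

variable (U) in
/-- A space embeds isometrically into its ultrapower. -/
theorem exists_diagonal : ∃ δ : E →L[ℝ] Ultrapower E U, ∀ x, ‖δ x‖ = ‖x‖ := by
  let c : E → lp (fun _ : I => E) ⊤ := fun x =>
    ⟨fun _ => x, memℓp_infty ⟨‖x‖, by rintro _ ⟨i, rfl⟩; exact le_rfl⟩⟩
  let l : E →ₗ[ℝ] lp (fun _ : I => E) ⊤ :=
    { toFun := c
      map_add' := fun x y => rfl
      map_smul' := fun r x => rfl }
  have hl : ∀ x i, l x i = x := fun x i => rfl
  have hnorm : ∀ x, ‖mk U (l x)‖ = ‖x‖ := fun x => le_antisymm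
    (norm_mk_le_of_eventually (Eventually.of_forall fun i => by rw [hl]))
    (le_norm_mk_of_eventually (Eventually.of_forall fun i => by rw [hl]))
  refine ⟨(mk U ∘ₗ l).mkContinuous 1 fun x => ?_, hnorm⟩
  rw [one_mul]
  exact (hnorm x).le

/-- Uniformly bounded linear maps on subspaces that eventually contain every vector have a limit
with values in the ultrapower. -/
theorem exists_limitMap {V : Type*} [NormedAddCommGroup V] [NormedSpace ℝ V]
    (D : I → Submodule ℝ V) (hD : ∀ v, ∀ᶠ i in U, v ∈ D i) (T : ∀ i, D i →ₗ[ℝ] E) (C : ℝ)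
    (hT : ∀ i a, ‖T i a‖ ≤ C * ‖a‖) :
    ∃ J : V →L[ℝ] Ultrapower E U, ∀ v, ∃ f : lp (fun _ : I => E) ⊤,
      J v = mk U f ∧ ∀ i (h : v ∈ D i), f i = T i ⟨v, h⟩ := by
  classical
  have hle : ∀ v i, ‖(if h : v ∈ D i then T i ⟨v, h⟩ else 0 : E)‖ ≤ max C 0 * ‖v‖ := fun v i => by
    split_ifs with h
    · exact (hT i _).trans (mul_le_mul_of_nonneg_right (le_max_left _ _) (norm_nonneg v))
    · rw [norm_zero]; positivity
  let c : V → lp (fun _ : I => E) ⊤ := fun v => ⟨fun i => if h : v ∈ D i then T i ⟨v, h⟩ else 0,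
    memℓp_infty ⟨max C 0 * ‖v‖, by rintro _ ⟨i, rfl⟩; exact hle v i⟩⟩
  have hc : ∀ v i (h : v ∈ D i), c v i = T i ⟨v, h⟩ := fun v i h => dif_pos h
  let l : V →ₗ[ℝ] Ultrapower E U :=
    { toFun := fun v => mk U (c v)
      map_add' := fun x y => by
        rw [← map_add]
        refine mk_eq_mk ?_
        filter_upwards [hD x, hD y] with i hx hy
        rw [lp.coeFn_add, Pi.add_apply, hc x i hx, hc y i hy, hc _ i (add_mem hx hy), ← map_add]
        rfl
      map_smul' := fun r x => by
        rw [RingHom.id_apply, ← map_smul]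
        refine mk_eq_mk ?_
        filter_upwards [hD x] with i hx
        rw [lp.coeFn_smul, Pi.smul_apply, hc x i hx, hc _ i (Submodule.smul_mem _ r hx),
          ← map_smul]
        rfl }
  refine ⟨l.mkContinuous (max C 0) fun v => ?_, fun v => ⟨c v, rfl, hc v⟩⟩
  exact (norm_mk_le _).trans (lp.norm_le_of_forall_le (by positivity) (hle v))

/-- Lift `A` linearly to bounded families. By compactness of its unit sphere, some single coordinate
of the lift is bounded between 1/2 and 2 on the whole sphere, hence has distortion at most 4. -/
theorem crudelyFinitelyRepresentable : CrudelyFinitelyRepresentable (Ultrapower E U) E := by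
  refine ⟨4, fun A _ => ?_⟩
  obtain ⟨s₀, hs₀⟩ := (mk U : lp (fun _ : I => E) ⊤ →ₗ[ℝ] _).exists_rightInverse_of_surjective
    (LinearMap.range_eq_top.2 mk_surjective)
  have hs₀' : ∀ x, mk U (s₀ x) = x := fun x => LinearMap.congr_fun hs₀ x
  let s : A →L[ℝ] lp (fun _ : I => E) ⊤ := LinearMap.toContinuousLinearMap (s₀ ∘ₗ A.subtype)
  have hs : ∀ a : A, mk U (s a) = a := fun a => hs₀' a
  have hev : ∀ᶠ i in U, ∀ a ∈ Metric.sphere (0 : A) 1, 1 / 2 ≤ ‖s a i‖ ∧ ‖s a i‖ ≤ 2 := by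
    by_contra hcon
    rw [← Ultrafilter.eventually_not] at hcon
    -- A bad unit vector is chosen at each bad index, with `0` as a dummy elsewhere. Their limit `b`
    -- along `U` is a unit vector whose coordinates are `U`-eventually near norm 1, which
    -- contradicts badness.
    have hch : ∀ i, ∃ a : A, (¬ ∀ a ∈ Metric.sphere (0 : A) 1, 1 / 2 ≤ ‖s a i‖ ∧ ‖s a i‖ ≤ 2) →
        a ∈ Metric.sphere (0 : A) 1 ∧ ¬ (1 / 2 ≤ ‖s a i‖ ∧ ‖s a i‖ ≤ 2) := fun i => by
      by_cases h : ∀ a ∈ Metric.sphere (0 : A) 1, 1 / 2 ≤ ‖s a i‖ ∧ ‖s a i‖ ≤ 2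
      · exact ⟨0, fun h' => absurd h h'⟩
      · have h' := h
        push Not at h'
        obtain ⟨a, ha, hlt⟩ := h'
        exact ⟨a, fun _ => ⟨ha, fun hh => absurd hh.2 (not_le.2 (hlt hh.1))⟩⟩
    choose a ha using hch
    have hsph : ∀ᶠ i in U, a i ∈ Metric.sphere (0 : A) 1 := hcon.mono fun i hi => (ha i hi).1
    have : ProperSpace A := FiniteDimensional.proper ℝ A
    obtain ⟨b, hb, hlim⟩ := (isCompact_sphere (0 : A) 1).ultrafilter_le_nhds (U.map a)
      (le_principal_iff.2 hsph)
    have hlim' : Tendsto a U (𝓝 b) := hlim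
    have hb1 : ‖mk U (s b)‖ = 1 := by
      rw [hs]
      simpa using hb
    have hclose : ∀ᶠ i in U, ‖s (a i) i - s b i‖ < 1 / 4 := by
      have h1 : Tendsto (fun i => s (a i)) U (𝓝 (s b)) := (s.continuous.tendsto b).comp hlim'
      filter_upwards [Metric.tendsto_nhds.1 h1 (1 / 4) (by norm_num)] with i hi
      rw [dist_eq_norm] at hi
      exact (lp.norm_apply_le_norm (by simp) (s (a i) - s b) i).trans_lt hi
    have hlow : ∀ᶠ i in U, 3 / 4 < ‖s b i‖ := by
      by_contra hc
      rw [← Ultrafilter.eventually_not] at hc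
      have := norm_mk_le_of_eventually (hc.mono fun i hi => not_lt.1 hi)
      norm_num [hb1] at this
    have hup : ∀ᶠ i in U, ‖s b i‖ < 5 / 4 := by
      by_contra hc
      rw [← Ultrafilter.eventually_not] at hc
      have := le_norm_mk_of_eventually (hc.mono fun i hi => not_lt.1 hi)
      norm_num [hb1] at this
    obtain ⟨i, h1, h2, h3, h4⟩ := (hcon.and (hclose.and (hlow.and hup))).exists
    refine (ha i h1).2 ?_
    have h5 := norm_sub_norm_le (s b i) (s (a i) i)
    have h6 := norm_sub_norm_le (s (a i) i) (s b i)
    rw [norm_sub_rev] at h5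
    constructor <;> linarith
  obtain ⟨i, hi⟩ := hev.exists
  let T₀ : A →ₗ[ℝ] E :=
    { toFun := fun a => s a i
      map_add' := fun x y => by rw [map_add]; rfl
      map_smul' := fun r x => by rw [map_smul]; rfl }
  refine ⟨LinearMap.toContinuousLinearMap T₀, 1 / 2, by norm_num, fun a => ?_⟩
  change 1 / 2 * ‖a‖ ≤ ‖T₀ a‖ ∧ ‖T₀ a‖ ≤ 4 * (1 / 2) * ‖a‖
  by_cases h0 : a = 0
  · simp [h0]
  have hpos : 0 < ‖a‖ := norm_pos_iff.2 h0
  obtain ⟨h1, h2⟩ := hi (‖a‖⁻¹ • a) (by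
    rw [mem_sphere_zero_iff_norm, norm_smul, norm_inv, norm_norm, inv_mul_cancel₀ hpos.ne'])
  have h3 : ‖s (‖a‖⁻¹ • a) i‖ = ‖T₀ a‖ / ‖a‖ := by
    change ‖T₀ (‖a‖⁻¹ • a)‖ = _
    rw [map_smul, norm_smul, norm_inv, norm_norm, inv_mul_eq_div]
  rw [h3, le_div_iff₀ hpos] at h1
  rw [h3, div_le_iff₀ hpos] at h2
  exact ⟨h1, by linarith⟩

/-- A dual space is complemented in its ultrapowers, by weak-star limits. -/
theorem exists_retraction (hdual : IsDualBanachSpace E) (U : Ultrafilter I) :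
    ∃ R : Ultrapower E U →L[ℝ] E, ∀ x (f : lp (fun _ : I => E) ⊤), (∀ i, f i = x) →
      R (mk U f) = x := by
  obtain ⟨W, _, _, _, ⟨φ⟩⟩ := hdual
  have hlim : ∀ (f : lp (fun _ : I => E) ⊤) (x : W), ∃ r : ℝ,
      Tendsto (fun i => φ (f i) x) U (𝓝 r) ∧ |r| ≤ ‖f‖ * ‖x‖ := fun f x => by
    have hb : ∀ i, φ (f i) x ∈ Set.Icc (-(‖f‖ * ‖x‖)) (‖f‖ * ‖x‖) := fun i => by
      refine abs_le.1 ?_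
      rw [← Real.norm_eq_abs]
      refine ((φ (f i)).le_opNorm x).trans (mul_le_mul_of_nonneg_right ?_ (norm_nonneg x))
      rw [φ.norm_map]
      exact lp.norm_apply_le_norm (by simp) f i
    obtain ⟨r, hr, hlim⟩ := isCompact_Icc.ultrafilter_le_nhds (U.map fun i => φ (f i) x)
      (le_principal_iff.2 (Eventually.of_forall (f := (U : Filter I)) hb))
    exact ⟨r, hlim, abs_le.2 hr⟩
  choose r hr hrb using hlim
  have huniq : ∀ f x t, Tendsto (fun i => φ (f i) x) U (𝓝 t) → r f x = t := fun f x t ht =>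
    tendsto_nhds_unique (hr f x) ht
  let ψ : lp (fun _ : I => E) ⊤ → StrongDual ℝ W := fun f =>
    LinearMap.mkContinuous
      { toFun := r f
        map_add' := fun x y => huniq _ _ _ (by
          simpa only [map_add] using (hr f x).add (hr f y))
        map_smul' := fun c x => huniq _ _ _ (by
          simpa only [map_smul, RingHom.id_apply] using (hr f x).const_smul c) } ‖f‖ (hrb f)
  let Ψ : lp (fun _ : I => E) ⊤ →ₗ[ℝ] StrongDual ℝ W :=
    { toFun := ψ
      map_add' := fun f g => by
        ext x
        refine huniq _ _ _ ?_
        have := (hr f x).add (hr g x)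
        refine this.congr fun i => ?_
        rw [lp.coeFn_add, Pi.add_apply, map_add]
        rfl
      map_smul' := fun c f => by
        ext x
        refine huniq _ _ _ ?_
        have := (hr f x).const_smul c
        refine this.congr fun i => ?_
        rw [lp.coeFn_smul, Pi.smul_apply, map_smul]
        rfl }
  have hΨ : ∀ f, ‖Ψ f‖ ≤ 1 * ‖f‖ := fun f => by
    rw [one_mul]
    exact LinearMap.mkContinuous_norm_le _ (norm_nonneg f) (hrb f)
  have hker : ∀ f ∈ nullFamilies E U, Ψ f = 0 := fun f hf => by
    ext x
    refine huniq _ _ _ ?_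
    have h1 : Tendsto (fun i => φ (f i)) U (𝓝 0) := by
      have := (φ.continuous.tendsto 0).comp (mem_nullFamilies.1 hf)
      rwa [map_zero] at this
    exact ((ContinuousLinearMap.apply ℝ ℝ x).continuous.tendsto 0).comp h1
  let Q : Ultrapower E U →L[ℝ] StrongDual ℝ W :=
    ((nullFamilies E U).liftQ Ψ hker).mkContinuous 1 fun z => by
      refine le_of_forall_pos_le_add fun ε hε => ?_
      obtain ⟨g, hg, hlt⟩ := Submodule.Quotient.norm_mk_lt (S := nullFamilies E U) z hε
      rw [← hg] at hlt ⊢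
      change ‖Ψ g‖ ≤ _
      linarith [hΨ g]
  refine ⟨(φ.symm : StrongDual ℝ W →L[ℝ] E).comp Q, fun x f hf => ?_⟩
  change φ.symm (Ψ f) = x
  rw [LinearIsometryEquiv.symm_apply_eq]
  ext y
  refine huniq _ _ _ ?_
  simp only [hf]
  exact tendsto_const_nhds

end Ultrapower

/-- Operators from subspaces of `Y` to `V` extend to `Y` once `V` is embedded in a suitable
ultrapower of the `f`-saturated space `E`. -/
theorem FSaturated.exists_ultrapower_extension (hsat : FSaturated E)
    (hinf : ¬ FiniteDimensional ℝ E)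
    {V : Type u} [NormedAddCommGroup V] [NormedSpace ℝ V]
    (T : ∀ S : Submodule ℝ V, S →L[ℝ] E) (C : ℝ) (hC : 0 ≤ C)
    (hT : ∀ S : Submodule ℝ V, FiniteDimensional ℝ S →
      ∀ a, ‖a‖ ≤ ‖T S a‖ ∧ ‖T S a‖ ≤ C * ‖a‖)
    {Y : Type u} [NormedAddCommGroup Y] [NormedSpace ℝ Y]
    (hY : CrudelyFinitelyRepresentable Y E) (Y₀ : Submodule ℝ Y) (w : Y₀ →L[ℝ] V) :
    ∃ (I : Type u) (U : Ultrafilter I) (J : V →L[ℝ] Ultrapower E U)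
      (w' : Y →L[ℝ] Ultrapower E U), (∀ y : Y₀, w' y = J (w y)) ∧ (∀ v, ‖v‖ ≤ ‖J v‖) ∧
      ∀ v x, (∀ S (h : v ∈ S), T S ⟨v, h⟩ = x) →
        ∃ f : lp (fun _ : I => E) ⊤, J v = Ultrapower.mk U f ∧ ∀ i, f i = x := by
  classical
  obtain ⟨K, hK, hY⟩ := hY.exists_normalized
  let I := Finset V × Finset Y
  -- Refining `atTop` makes every fixed vector of `V` or `Y` lie in the indexed spans for `U`-almost
  -- all indices.
  let U : Ultrafilter I := Ultrafilter.of atTop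
  have hU : ∀ {p : I → Prop}, (∀ᶠ i in atTop, p i) → ∀ᶠ i in U, p i := fun h =>
    Ultrafilter.of_le atTop h
  let B : I → Submodule ℝ Y := fun i => Submodule.span ℝ (i.2 : Set Y)
  have hBfin : ∀ i, FiniteDimensional ℝ (B i) := fun i => FiniteDimensional.span_finset ℝ i.2
  let A : ∀ i, Submodule ℝ (B i) := fun i => Y₀.comap (B i).subtype
  let r : ∀ i, A i →ₗ[ℝ] Y₀ := fun i =>
    LinearMap.codRestrict Y₀ ((B i).subtype ∘ₗ (A i).subtype) fun a => a.2
  -- Including `w (A i)` lets the same map `T (D i)` define `J` and the operator extended to `B i`,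
  -- so the two limits agree on `Y₀`.
  let D : I → Submodule ℝ V := fun i =>
    Submodule.span ℝ (i.1 : Set V) ⊔ LinearMap.range (w.toLinearMap ∘ₗ r i)
  have hDfin : ∀ i, FiniteDimensional ℝ (D i) := fun i => by
    have := FiniteDimensional.span_finset ℝ i.1
    exact Submodule.finiteDimensional_sup _ _
  have hB : ∀ y, ∀ᶠ i in U, y ∈ B i := fun y => hU (by
    filter_upwards [eventually_ge_atTop ((∅, {y}) : I)] with i hi
    exact Submodule.subset_span (hi.2 (Finset.mem_singleton_self y)))
  have hD : ∀ v, ∀ᶠ i in U, v ∈ D i := fun v => hU (by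
    filter_upwards [eventually_ge_atTop (({v}, ∅) : I)] with i hi
    exact Submodule.mem_sup_left (Submodule.subset_span (hi.1 (Finset.mem_singleton_self v))))
  let wA : ∀ i, A i →ₗ[ℝ] D i := fun i =>
    LinearMap.codRestrict (D i) (w.toLinearMap ∘ₗ r i) fun a =>
      Submodule.mem_sup_right (LinearMap.mem_range_self _ a)
  -- The `+ 1` keeps the bound positive when `w = 0`, as the local extension requires.
  have hwA : ∀ i a, ‖((T (D i)).toLinearMap ∘ₗ wA i) a‖ ≤ (C * ‖w‖ + 1) * ‖a‖ := fun i a => by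
    have h1 : ‖T (D i) (wA i a)‖ ≤ C * ‖wA i a‖ := (hT (D i) (hDfin i) _).2
    have h2 : ‖wA i a‖ ≤ ‖w‖ * ‖a‖ := w.le_opNorm (r i a)
    have h3 : C * ‖wA i a‖ ≤ C * (‖w‖ * ‖a‖) := mul_le_mul_of_nonneg_left h2 hC
    change ‖T (D i) (wA i a)‖ ≤ _
    linarith [norm_nonneg a]
  have hS : ∀ i, ∃ S : B i →ₗ[ℝ] E, (∀ a : A i, S a = T (D i) (wA i a)) ∧
      ∀ b, ‖S b‖ ≤ 20 * (C * ‖w‖ + 1) * K * ‖b‖ := fun i => by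
    obtain ⟨R, hR⟩ := hY (B i) (hBfin i)
    exact hsat.exists_extension hinf R K hR (A i) ((T (D i)).toLinearMap ∘ₗ wA i) _
      (by positivity) (hwA i)
  choose S hSA hSb using hS
  obtain ⟨J, hJ⟩ := Ultrapower.exists_limitMap D hD (fun i => (T (D i)).toLinearMap) C
    fun i a => (hT (D i) (hDfin i) a).2
  obtain ⟨w', hw'⟩ := Ultrapower.exists_limitMap B hB S _ hSb
  refine ⟨I, U, J, w', fun y => ?_, fun v => ?_, fun v x hv => ?_⟩
  · obtain ⟨f, hf, hf'⟩ := hJ (w y)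
    obtain ⟨g, hg, hg'⟩ := hw' y
    rw [hf, hg]
    refine Ultrapower.mk_eq_mk ?_
    filter_upwards [hB y] with i hi
    have hmem : w y ∈ D i := (wA i ⟨⟨y, hi⟩, y.2⟩).2
    rw [hg' i hi, hf' i hmem]
    exact hSA i ⟨⟨y, hi⟩, y.2⟩
  · obtain ⟨f, hf, hf'⟩ := hJ v
    rw [hf]
    refine Ultrapower.le_norm_mk_of_eventually ?_
    filter_upwards [hD v] with i hi
    rw [hf' i hi]
    exact (hT (D i) (hDfin i) ⟨v, hi⟩).1
  · obtain ⟨f, hf, hf'⟩ := hJ v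
    let g : lp (fun _ : I => E) ⊤ :=
      ⟨fun _ => x, memℓp_infty ⟨‖x‖, by rintro _ ⟨i, rfl⟩; exact le_rfl⟩⟩
    refine ⟨g, hf.trans (Ultrapower.mk_eq_mk ?_), fun i => rfl⟩
    filter_upwards [hD v] with i hi
    rw [hf' i hi]
    exact hv _ hi

end Ultrapower

/-! ### Making an embedding isometric by renorming its target -/

section Renorming

variable {G V : Type u} [NormedAddCommGroup G] [NormedSpace ℝ G] [CompleteSpace G]
  [NormedAddCommGroup V] [NormedSpace ℝ V] [CompleteSpace V]

/-- A Banach space can be renormed so that a given isomorphic embedding becomes isometric. -/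
theorem exists_renorming (J : V →L[ℝ] G) (hJ : ∀ v, ‖v‖ ≤ ‖J v‖) :
    ∃ (Z : Type u) (_ : NormedAddCommGroup Z) (_ : NormedSpace ℝ Z) (_ : CompleteSpace Z)
      (j : V →ₗᵢ[ℝ] Z) (e : G ≃L[ℝ] Z), ∀ v, e (J v) = j v := by
  -- The quotient of the ℓ¹-sum by the kernel of `π` is `G` with the norm `inf {‖g‖ + ‖v‖ : g + J v
  -- = z}`; `(J v, 0)` and `(0, v)` have the same class.
  let π : WithLp 1 (G × V) →L[ℝ] G :=
    (ContinuousLinearMap.fst ℝ G V + J.comp (ContinuousLinearMap.snd ℝ G V)).comp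
      (WithLp.prodContinuousLinearEquiv 1 ℝ G V).toContinuousLinearMap
  have hπ : ∀ p, π p = p.fst + J p.snd := fun p => rfl
  let N : Submodule ℝ (WithLp 1 (G × V)) := LinearMap.ker π.toLinearMap
  have hN : ∀ p, p ∈ N ↔ p.fst + J p.snd = 0 := fun p => Iff.rfl
  have : IsClosed (N : Set (WithLp 1 (G × V))) := π.isClosed_ker
  let ι := (WithLp.linearEquiv 1 ℝ (G × V)).symm.toLinearMap
  have hι : ∀ p, ‖ι p‖ = ‖p.1‖ + ‖p.2‖ := fun p => WithLp.prod_norm_eq_of_L1 _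
  let j₀ : V →ₗ[ℝ] _ ⧸ N := N.mkQ ∘ₗ ι ∘ₗ LinearMap.inr ℝ G V
  have hj : ∀ v, ‖j₀ v‖ = ‖v‖ := fun v => by
    refine le_antisymm ?_ (le_of_forall_pos_le_add fun ε hε => ?_)
    · refine (Submodule.Quotient.norm_mk_le N (ι (0, v))).trans ?_
      rw [hι, norm_zero, zero_add]
    · obtain ⟨p, hp, hlt⟩ := Submodule.Quotient.norm_mk_lt (S := N) (j₀ v) hε
      have hmem := (hN _).1 ((Submodule.Quotient.eq N).1 hp)
      -- Any representative of the class of `(0, v)` is `(J (v - u), u)`, of norm at least `‖v - u‖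
      -- + ‖u‖ ≥ ‖v‖` by `hJ`.
      have h1 : p.fst = J (v - p.snd) := by
        have h2 : p.fst - 0 + J (p.snd - v) = 0 := hmem
        rw [sub_zero] at h2
        rw [eq_neg_of_add_eq_zero_left h2, ← map_neg, neg_sub]
      rw [WithLp.prod_norm_eq_of_L1, h1] at hlt
      have h3 : ‖v‖ ≤ ‖v - p.snd‖ + ‖p.snd‖ := by simpa using norm_add_le (v - p.snd) p.snd
      linarith [hJ (v - p.snd)]
  let a : G →L[ℝ] _ ⧸ N := (N.mkQ ∘ₗ ι ∘ₗ LinearMap.inl ℝ G V).mkContinuous 1 fun z => by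
    refine (Submodule.Quotient.norm_mk_le N (ι (z, 0))).trans ?_
    rw [hι, norm_zero, add_zero, one_mul]
  let b : (_ ⧸ N) →L[ℝ] G := (N.liftQ π.toLinearMap le_rfl).mkContinuous ‖π‖ fun z => by
    refine le_of_forall_pos_le_add fun ε hε => ?_
    obtain ⟨p, hp, hlt⟩ := Submodule.Quotient.norm_mk_lt (S := N) z
      (ε := ε / (‖π‖ + 1)) (by positivity)
    rw [← hp] at hlt ⊢
    have h1 : ‖π p‖ ≤ ‖π‖ * ‖p‖ := π.le_opNorm p
    have h2 : ‖π‖ * ‖p‖ ≤ ‖π‖ * (‖(Submodule.Quotient.mk p : _ ⧸ N)‖ + ε / (‖π‖ + 1)) :=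
      mul_le_mul_of_nonneg_left hlt.le (norm_nonneg _)
    have h3 : ‖π‖ * (ε / (‖π‖ + 1)) ≤ ε := by
      rw [mul_div_assoc', div_le_iff₀ (by positivity)]
      nlinarith [norm_nonneg π]
    change ‖π p‖ ≤ _
    linarith
  refine ⟨_ ⧸ N, inferInstance, inferInstance, inferInstance, ⟨j₀, hj⟩,
    ContinuousLinearEquiv.equivOfInverse a b (fun z => ?_) (fun z => ?_), fun v => ?_⟩
  · change z + J 0 = z
    rw [map_zero, add_zero]
  · obtain ⟨p, rfl⟩ := N.mkQ_surjective z
    refine (Submodule.Quotient.eq N).2 ((hN _).2 ?_)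
    change (p.fst + J p.snd - p.fst) + J (0 - p.snd) = 0
    rw [zero_sub, map_neg]
    abel
  · refine (Submodule.Quotient.eq N).2 ((hN _).2 ?_)
    change (J v - 0) + J (0 - v) = 0
    rw [sub_zero, zero_sub, map_neg, add_neg_cancel]

end Renorming

/-! ### Comparison of the classes 𝔓~ and 𝔍~ -/

section Classes

variable {X : Type u} [NormedAddCommGroup X] [NormedSpace ℝ X]
  {V : Type u} [NormedAddCommGroup V] [NormedSpace ℝ V]

/-- A projection onto an isometric copy of `V` yields a retraction onto `V`. -/
theorem exists_retraction_of_projection {Z : Type u} [NormedAddCommGroup Z] [NormedSpace ℝ Z]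
    (j : V →ₗᵢ[ℝ] Z) (P : Z →L[ℝ] Z) (hP : ∀ z, P (P z) = P z)
    (hrange : Set.range P = Set.range j) : ∃ q : Z →L[ℝ] V, ∀ v, q (j v) = v := by
  have hmem : ∀ z, P z ∈ LinearMap.range j.toLinearMap := fun z => by
    have h : P z ∈ Set.range j := hrange ▸ Set.mem_range_self z
    exact h
  refine ⟨(j.equivRange.symm : LinearMap.range j.toLinearMap →L[ℝ] V).comp
    (P.codRestrict _ hmem), fun v => ?_⟩
  change j.equivRange.symm _ = v
  rw [LinearIsometryEquiv.symm_apply_eq]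
  refine Subtype.ext ?_
  change P (j v) = j v
  obtain ⟨z, hz⟩ : j v ∈ Set.range P := hrange ▸ Set.mem_range_self v
  rw [← hz, hP]

/-- The inverse of `j`, defined on its closed range, extends to an operator `q : Z → V`; then `j ∘
q` is the projection. -/
theorem MemJTilde.memPTilde [CompleteSpace V] (hinf : ¬ FiniteDimensional ℝ V)
    (h : MemJTilde X V) : MemPTilde X V := by
  refine ⟨hinf, h.1, fun Z _ _ _ hZ j => ?_⟩
  obtain ⟨q, hq⟩ := h.2 Z hZ.1 (LinearMap.range j.toLinearMap)
    j.isometry.isClosedEmbedding.isClosed_range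
    (j.equivRange.symm : LinearMap.range j.toLinearMap →L[ℝ] V)
  have hq' : ∀ v, q (j v) = v := fun v =>
    (hq (j.equivRange v)).trans (j.equivRange.symm_apply_apply v)
  refine ⟨j.toContinuousLinearMap.comp q, fun z => ?_, Set.Subset.antisymm ?_ ?_⟩
  · change j (q (j (q z))) = j (q z)
    rw [hq']
  · rintro _ ⟨z, rfl⟩
    exact ⟨q z, rfl⟩
  · rintro _ ⟨v, rfl⟩
    exact ⟨j v, congrArg j (hq' v)⟩

theorem MemJTilde.of_retract {F : Submodule ℝ V} (h : MemJTilde X V)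
    (hF : F.ClosedComplemented) : MemJTilde X F := by
  obtain ⟨R, hR⟩ := hF
  refine ⟨F.finitelyRepresentable.crudely.trans h.1, fun Y _ _ _ hY Y₀ hY₀ w => ?_⟩
  obtain ⟨w', hw'⟩ := h.2 Y hY Y₀ hY₀ (F.subtypeL.comp w)
  refine ⟨R.comp w', fun y => ?_⟩
  rw [ContinuousLinearMap.comp_apply, hw']
  exact hR (w y)

variable {E : Type u} [NormedAddCommGroup E] [NormedSpace ℝ E]

theorem FSaturated.memJTilde_of_isDual (hEX : CrudelyFinitelyEquivalent E X)
    (hsat : FSaturated E) (hinf : ¬ FiniteDimensional ℝ E) (hdual : IsDualBanachSpace E) :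
    MemJTilde X E := by
  refine ⟨hEX.1, fun Y _ _ _ hY Y₀ _ w => ?_⟩
  obtain ⟨I, U, J, w', hw', -, hJ⟩ := hsat.exists_ultrapower_extension hinf
    (fun S : Submodule ℝ E => S.subtypeL) 1 zero_le_one
    (fun S _ a => ⟨le_rfl, by rw [one_mul]; exact le_rfl⟩) (hY.trans hEX.2) Y₀ w
  obtain ⟨R, hR⟩ := Ultrapower.exists_retraction hdual U
  refine ⟨R.comp w', fun y => ?_⟩
  -- All local maps are inclusions, so `J` sends a vector to the class of its constant family, where
  -- the weak-star retraction recovers it.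
  obtain ⟨f, hf, hfx⟩ := hJ (w y) (w y) fun S h => rfl
  rw [ContinuousLinearMap.comp_apply, hw', hf]
  exact hR _ f hfx

/-- Membership in `X^F` is invariant under isomorphism, so the renormed ultrapower is an admissible
`Z` for the projection property. -/
theorem MemPTilde.memJTilde [CompleteSpace E] [CompleteSpace V]
    (hEX : CrudelyFinitelyEquivalent E X) (hsat : FSaturated E)
    (hinf : ¬ FiniteDimensional ℝ E) (h : MemPTilde X V) : MemJTilde X V := by
  refine ⟨h.2.1, fun Y _ _ _ hY Y₀ _ w => ?_⟩
  obtain ⟨C, hC, hV⟩ := (h.2.1.trans hEX.2).exists_normalized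
  have hT : ∀ S : Submodule ℝ V, ∃ T : S →L[ℝ] E, FiniteDimensional ℝ S →
      ∀ a, ‖a‖ ≤ ‖T a‖ ∧ ‖T a‖ ≤ C * ‖a‖ := fun S => by
    by_cases hS : FiniteDimensional ℝ S
    · obtain ⟨T, hT⟩ := hV S hS
      exact ⟨T, fun _ => hT⟩
    · exact ⟨0, fun h' => absurd h' hS⟩
  choose T hT using hT
  obtain ⟨I, U, J, w', hw', hJ, -⟩ := hsat.exists_ultrapower_extension hinf T C hC hT
    (hY.trans hEX.2) Y₀ w
  obtain ⟨Z, _, _, _, j, e, hej⟩ := exists_renorming J hJ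
  have hiso : ∀ {A B : Type u} [NormedAddCommGroup A] [NormedSpace ℝ A] [NormedAddCommGroup B]
      [NormedSpace ℝ B] (e : A ≃L[ℝ] B), CrudelyFinitelyRepresentable A B :=
      fun {A B} _ _ _ _ e => by
    refine .of_boundedBelow (e : A →L[ℝ] B) (‖(e.symm : B →L[ℝ] A)‖ + 1)⁻¹ (by positivity)
      fun a => ?_
    rw [inv_mul_le_iff₀ (by positivity)]
    have h1 := (e.symm : B →L[ℝ] A).le_opNorm (e a)
    have h2 : (e.symm : B →L[ℝ] A) (e a) = a := e.symm_apply_apply a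
    rw [h2] at h1
    change ‖a‖ ≤ _ * ‖e a‖
    linarith [norm_nonneg (e a)]
  obtain ⟨δ, hδ⟩ := Ultrapower.exists_diagonal (E := E) U
  have hEU : CrudelyFinitelyRepresentable E (Ultrapower E U) :=
    .of_boundedBelow δ 1 one_pos fun x => by rw [hδ, one_mul]
  have hZ : CrudelyFinitelyEquivalent Z X :=
    ⟨((hiso e.symm).trans Ultrapower.crudelyFinitelyRepresentable).trans hEX.1,
      hEX.2.trans (hEU.trans (hiso e))⟩
  obtain ⟨P, hP, hrange⟩ := h.2.2 Z hZ j
  obtain ⟨q, hq⟩ := exists_retraction_of_projection j P hP hrange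
  refine ⟨q.comp ((e : Ultrapower E U →L[ℝ] Z).comp w'), fun y => ?_⟩
  change q (e (w' y)) = w y
  rw [hw', hej, hq]

end Classes

/-- `MemJTilde` does not include infinite-dimensionality, so the comparison of the classes assumes
it of `V`. -/
theorem mainTheorem10
    (X : Type u) [NormedAddCommGroup X] [NormedSpace ℝ X] [CompleteSpace X]
    (E : Type u) [NormedAddCommGroup E] [NormedSpace ℝ E] [CompleteSpace E]
    (hEX : FinitelyEquivalent E X) (hsat : FSaturated E) (hdual : IsDualBanachSpace E)
    (F : Submodule ℝ E) (hF : F.ClosedComplemented) (hinf : ¬ FiniteDimensional ℝ F) :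
    MemPTilde X F ∧ MemJTilde X F ∧
      ∀ (V : Type u) [NormedAddCommGroup V] [NormedSpace ℝ V] [CompleteSpace V],
        ¬ FiniteDimensional ℝ V → (MemPTilde X V ↔ MemJTilde X V) := by
  have hEX' : CrudelyFinitelyEquivalent E X := ⟨hEX.1.crudely, hEX.2.crudely⟩
  have hE : ¬ FiniteDimensional ℝ E := fun _ => hinf inferInstance
  have : CompleteSpace F := hF.isClosed.completeSpace_coe
  have hJ : MemJTilde X F := (hsat.memJTilde_of_isDual hEX' hE hdual).of_retract hF
  exact ⟨hJ.memPTilde hinf, hJ, fun V _ _ _ hV =>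
    ⟨fun h => h.memJTilde hEX' hsat hE, fun h => h.memPTilde hV⟩⟩
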